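/- Let $\mathcal{F}$ be a free filter on $\mathbb{N}$, that is, a proper filter with $\bigcap\mathcal{F}=\emptyset$. Let $\xi(\mathcal{F})$ be the topological space with underlying set $\mathbb{N}\cup\{\mathcal{F}\}$ in which every point of $\mathbb{N}$ is isolated and the neighbourhoods of the point $\mathcal{F}$ are the sets $A\cup\{\mathcal{F}\}$ with $A\in\mathcal{F}$. Suppose that $\mathcal{F}$ is a Fréchet–Urysohn filter, i.e. that $\xi(\mathcal{F})$ is a Fréchet–Urysohn space. For a topological space $X$, a nontrivial convergent sequence of $X$ is a countably infinite set $S\subseteq X$ such that the subspace $S$ has exactly one non-isolated point $x_S$, and $S\setminus U$ is finite for every neighbourhood $U$ of $x_S$. Let $\mathcal{S}_c(X)$ be the set of all nonempty closed subsets of $X$ that are nontrivial convergent sequences, with the Vietoris topology: the sets $\{S\in\mathcal{S}_c(X) : S\subseteq U_1\cup\dots\cup U_n,\ S\cap U_i\neq\emptyset \text{ for } 1\le i\le n\}$, where $n\ge 1$ and $U_1,\dots,U_n$ are nonempty open subsets of $X$, form a base. Then $\mathcal{S}_c(\xi(\mathcal{F}))$ is homeomorphic to the space $\mathbb{P}$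 of irrational numbers (with the topology inherited from $\mathbb{R}$) if and only if $\mathcal{F}$ has a countable base, i.e. there is a countable family $\mathcal{B}\subseteq\mathcal{F}$ such that every member of $\mathcal{F}$ contains a member of $\mathcal{B}$. -/

import Mathlib

open Filter Topology

/-- `CL(X)`: the nonempty closed subsets of `X`. -/
@[ext]
structure ClosedHyperspace (X : Type*) [TopologicalSpace X] where
  /-- The underlying set. -/
  carrier : Set X
  isClosed : IsClosed carrier
  nonempty : carrier.Nonempty

/-- The Vietoris topology on `CL(X)`: the subspace topology from Mathlib's Vietoris topology on
`Set X`, generated by the sets `{A | A ⊆ U}` and `{A | A ∩ U ≠ ∅}` with `U` open. -/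
instance ClosedHyperspace.instTopologicalSpace (X : Type*) [TopologicalSpace X] :
    TopologicalSpace (ClosedHyperspace X) :=
  TopologicalSpace.induced ClosedHyperspace.carrier (TopologicalSpace.vietoris X)

/-- The set `⟨𝒰⟩` of all `F ∈ CL(X)` with `F ⊆ ⋃ 𝒰` and `F ∩ U ≠ ∅` for every `U ∈ 𝒰`. -/
def ClosedHyperspace.bracket {X : Type*} [TopologicalSpace X] (𝒰 : Set (Set X)) :
    Set (ClosedHyperspace X) :=
  {F | F.carrier ⊆ ⋃₀ 𝒰 ∧ ∀ U ∈ 𝒰, (F.carrier ∩ U).Nonempty}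

/-- The sets `⟨𝒰⟩`, with `𝒰` a nonempty finite family of nonempty open sets, are a base of the
topology of `CL(X)`. -/
theorem ClosedHyperspace.isTopologicalBasis (X : Type*) [TopologicalSpace X] :
    TopologicalSpace.IsTopologicalBasis
      {W : Set (ClosedHyperspace X) | ∃ 𝒰 : Set (Set X), 𝒰.Finite ∧ 𝒰.Nonempty ∧
        (∀ U ∈ 𝒰, IsOpen U ∧ U.Nonempty) ∧ W = ClosedHyperspace.bracket 𝒰} := by
  have hb := @TopologicalSpace.IsTopologicalBasis.induced (Set X) (ClosedHyperspace X)
    (TopologicalSpace.vietoris X) ClosedHyperspace.carrier _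
    (TopologicalSpace.vietoris.isTopologicalBasis (α := X))
  refine TopologicalSpace.isTopologicalBasis_of_isOpen_of_nhds ?_ ?_
  · rintro _ ⟨u, hu, -, ho, rfl⟩
    exact hb.isOpen ⟨_, ⟨u, ⟨hu, fun U hU => (ho U hU).1⟩, rfl⟩, rfl⟩
  · intro F W hF hW
    obtain ⟨_, ⟨_, ⟨u, ⟨hu, ho⟩, rfl⟩, rfl⟩, hFu, hsub⟩ := hb.exists_subset_of_mem_open hF hW
    refine ⟨_, ⟨u, hu, ?_, fun U hU => ⟨ho U hU, ?_⟩, rfl⟩, hFu, hsub⟩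
    · obtain ⟨x, hx⟩ := F.nonempty
      obtain ⟨U, hU, -⟩ := hFu.1 hx
      exact ⟨U, hU⟩
    · exact (hFu.2 U hU).mono Set.inter_subset_right

/-- `S` is a nontrivial convergent sequence of `X`: a countably infinite set which, as a subspace,
has exactly one non-isolated point `x`, and `S \ U` is finite for each neighbourhood `U` of `x`. -/
def IsNontrivialConvergentSeq {X : Type*} [TopologicalSpace X] (S : Set X) : Prop :=
  S.Countable ∧ S.Infinite ∧
    ∃ x ∈ S, (∀ y ∈ S, AccPt y (𝓟 S) ↔ y = x) ∧ ∀ U ∈ 𝓝 x, (S \ U).Finite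

/-- `𝓢_c(X)`, the hyperspace of nontrivial convergent sequences, as a subspace of `CL(X)`. -/
def Sc (X : Type*) [TopologicalSpace X] : Set (ClosedHyperspace X) :=
  {S | IsNontrivialConvergentSeq S.carrier}

/-- A free filter on `ℕ`: a proper filter whose members have empty intersection. -/
def IsFreeFilter (F : Filter ℕ) : Prop :=
  F.NeBot ∧ ⋂₀ F.sets = ∅

/-- The underlying set `ℕ ∪ {F}` of `ξ(F)`: a copy of `ℕ` and one extra point `limit`. -/
inductive XiSpace (F : Filter ℕ) : Type
  | pt (n : ℕ) : XiSpace F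
  | limit : XiSpace F

/-- The topology of `ξ(F)`: the points `pt n` are isolated, and the neighbourhoods of `limit` are
the sets `{limit} ∪ pt '' A` with `A ∈ F` (see `XiSpace.mem_nhds_limit_iff`). -/
instance XiSpace.instTopologicalSpace (F : Filter ℕ) : TopologicalSpace (XiSpace F) :=
  nhdsAdjoint XiSpace.limit (Filter.map XiSpace.pt F)

theorem XiSpace.isOpen_singleton_pt (F : Filter ℕ) (n : ℕ) :
    IsOpen ({XiSpace.pt n} : Set (XiSpace F)) :=
  isOpen_singleton_nhdsAdjoint _ (by simp)

theorem XiSpace.mem_nhds_limit_iff (F : Filter ℕ) (U : Set (XiSpace F)) :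
    U ∈ 𝓝 (XiSpace.limit : XiSpace F) ↔
      ∃ A ∈ F, U = insert XiSpace.limit (XiSpace.pt '' A) := by
  have h : 𝓝 (XiSpace.limit : XiSpace F) = pure XiSpace.limit ⊔ Filter.map XiSpace.pt F :=
    nhds_nhdsAdjoint_same _ _
  rw [h, Filter.mem_sup, Filter.mem_pure, Filter.mem_map]
  constructor
  · rintro ⟨h1, h2⟩
    refine ⟨_, h2, ?_⟩
    ext (n | _)
    · simp
    · simpa using h1
  · rintro ⟨A, hA, rfl⟩
    refine ⟨Set.mem_insert _ _, Filter.mem_of_superset hA fun n hn => ?_⟩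
    exact Set.mem_insert_of_mem _ ⟨n, hn, rfl⟩

/-- A Fréchet–Urysohn filter: a free filter `F` on `ℕ` for which `ξ(F)` is Fréchet–Urysohn. -/
def IsFrechetUrysohnFilter (F : Filter ℕ) : Prop :=
  IsFreeFilter F ∧ FrechetUrysohnSpace (XiSpace F)

/-- `F` has a countable base: there is a countable family `B ⊆ F` such that every member of `F`
contains a member of `B`. -/
def HasCountableBase (F : Filter ℕ) : Prop :=
  ∃ B : Set (Set ℕ), B.Countable ∧ B ⊆ F.sets ∧ ∀ A ∈ F, ∃ b ∈ B, b ⊆ A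

/-! A sequence in `XiSpace F` is coded by its trace: an infinite `A ⊆ ℕ` with `A \ B` finite for all
`B ∈ F`. Basic Vietoris neighbourhoods then read `s ⊆ A ⊆ B` with `s` finite and `B ∈ F`
(`Sc.exists_trace_subset_of_isOpen`). A homeomorphism with the irrationals gives some sequence a
countable neighbourhood base; adding single points to that sequence turns the sets `B` of this base,
modulo finite sets, into a base of `F` (`Sc.hasCountableBase`). Conversely, if `F` has a countable
base, the hyperspace is nonempty, Polish (`Sc.polishSpace`), zero-dimensional and nowhere compact.
The Alexandrov–Urysohn theorem identifies it, like the irrationals, with `ℕ → ℕ`. -/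

/-! ### Polish spaces, the Baire space and the irrationals. -/

/-- An intersection of open sets `U n` embeds diagonally as a closed subset of the Polish product `∀
n, U n`. -/
theorem IsGδ.polishSpace {α : Type*} [TopologicalSpace α] [PolishSpace α] {s : Set α}
    (hs : IsGδ s) : PolishSpace s := by
  obtain ⟨U, hU, rfl⟩ := isGδ_iff_eq_iInter_nat.1 hs
  have : ∀ n, PolishSpace (U n) := fun n => (hU n).polishSpace
  let f : (⋂ n, U n : Set α) → ∀ n, U n := fun x n => ⟨x, Set.mem_iInter.1 x.2 n⟩
  have hf : Continuous f := by fun_prop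
  have hval : Continuous fun g : ∀ n, U n => (g 0 : α) := by fun_prop
  have hind : IsInducing f :=
    .of_comp hf hval (show IsInducing (Subtype.val : (⋂ n, U n : Set α) → α) from .subtypeVal)
  have hinj : Function.Injective f := fun x y h =>
    Subtype.ext (congrArg (fun g : ∀ n, U n => (g 0 : α)) h)
  have hrange : Set.range f = {g | ∀ n, (g n : α) = g 0} := by
    ext g
    constructor
    · rintro ⟨x, rfl⟩ n
      rfl
    · intro hg
      refine ⟨⟨g 0, Set.mem_iInter.2 fun n => ?_⟩, funext fun n => Subtype.ext (hg n).symm⟩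
      rw [← hg n]
      exact (g n).2
  have hclosed : IsClosed (Set.range f) := by
    rw [hrange]
    simp only [Set.ofPred_forall]
    exact isClosed_iInter fun n => isClosed_eq (by fun_prop) hval
  exact IsClosedEmbedding.polishSpace ⟨⟨hind, hinj⟩, hclosed⟩

open TopologicalSpace in
/-- In a zero-dimensional separable metric space, a noncompact clopen set can be split into
infinitely many nonempty clopen pieces of small diameter. -/
theorem IsClopen.exists_partition {X : Type*} [MetricSpace X] [SecondCountableTopology X]
    (hX : IsTopologicalBasis {s : Set X | IsClopen s}) {U : Set X} (hU : IsClopen U)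
    (hcomp : ¬ IsCompact U) {ε : ENNReal} (hε : 0 < ε) :
    ∃ V : ℕ → Set X, (∀ n, IsClopen (V n)) ∧ (∀ n, (V n).Nonempty) ∧
      (∀ n, Metric.ediam (V n) ≤ ε) ∧ Pairwise (fun m n => Disjoint (V m) (V n)) ∧
      ⋃ n, V n = U := by
  rw [isCompact_iff_finite_subcover] at hcomp
  push Not at hcomp
  obtain ⟨ι, O, hO, hUO, hfin⟩ := hcomp
  have h2 : (0 : ENNReal) < ε / 2 := ENNReal.half_pos hε.ne'
  have key : ∀ x : U, ∃ W : Set X, IsClopen W ∧ (x : X) ∈ W ∧ W ⊆ U ∧ Metric.ediam W ≤ ε ∧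
      ∃ i, W ⊆ O i := by
    intro x
    obtain ⟨i, hi⟩ := Set.mem_iUnion.1 (hUO x.2)
    obtain ⟨W, hW, hxW, hsub⟩ := hX.exists_subset_of_mem_open
      (show (x : X) ∈ U ∩ O i ∩ Metric.eball (x : X) (ε / 2) from
        ⟨⟨x.2, hi⟩, Metric.mem_eball_self h2⟩)
      ((hU.isOpen.inter (hO i)).inter Metric.isOpen_eball)
    refine ⟨W, hW, hxW, fun y hy => (hsub hy).1.1, ?_, i, fun y hy => (hsub hy).1.2⟩
    calc Metric.ediam W ≤ Metric.ediam (Metric.eball (x : X) (ε / 2)) :=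
          Metric.ediam_mono fun y hy => (hsub hy).2
      _ ≤ 2 * (ε / 2) := Metric.ediam_eball_le
      _ = ε := ENNReal.mul_div_cancel (by simp) (by simp)
  choose W hWc hxW hWU hWd c hWO using key
  have hUne : U.Nonempty := by
    by_contra h
    rw [Set.not_nonempty_iff_eq_empty] at h
    exact hfin ∅ (by simp [h])
  obtain ⟨T, hT, hTU⟩ := isOpen_iUnion_countable W fun x => (hWc x).isOpen
  have hcover : ⋃ x, W x = U :=
    (Set.iUnion_subset hWU).antisymm fun x hx => Set.mem_iUnion.2 ⟨⟨x, hx⟩, hxW ⟨x, hx⟩⟩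
  rw [hcover] at hTU
  have hTne : T.Nonempty := by
    by_contra h
    rw [Set.not_nonempty_iff_eq_empty] at h
    simp [h] at hTU
    exact hUne.ne_empty hTU.symm
  obtain ⟨t, rfl⟩ := hT.exists_eq_range hTne
  rw [Set.biUnion_range] at hTU
  let D : ℕ → Set X := disjointed fun n => W (t n)
  have hDW : ∀ n, D n ⊆ W (t n) := fun n => disjointed_subset _ n
  have hDc : ∀ n, IsClopen (D n) := fun n =>
    disjointedRec (fun {_ _} h => h.diff (hWc _)) (hWc _)
  have hDU : ⋃ n, D n = U := iUnion_disjointed.trans hTU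
  -- Each piece lies in one `O i`, so finitely many nonempty pieces would yield a finite subcover of
  -- `U`.
  have hinf : {n | (D n).Nonempty}.Infinite := by
    intro h
    classical
    refine hfin (h.toFinset.image fun n => c (t n)) fun x hx => ?_
    rw [← hDU] at hx
    obtain ⟨n, hn⟩ := Set.mem_iUnion.1 hx
    simp only [Finset.mem_image, Set.Finite.mem_toFinset, Set.mem_iUnion]
    exact ⟨_, ⟨n, ⟨x, hn⟩, rfl⟩, hWO _ (hDW n hn)⟩
  let e := Nat.nth fun n => (D n).Nonempty
  refine ⟨fun n => D (e n), fun n => hDc _, fun n => Nat.nth_mem_of_infinite hinf n,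
    fun n => (Metric.ediam_mono (hDW _)).trans (hWd _),
    fun m n hmn => disjoint_disjointed _ ((Nat.nth_injective hinf).ne hmn), ?_⟩
  rw [← hDU]
  refine (Set.iUnion_subset fun n => Set.subset_iUnion D _).antisymm
    (Set.iUnion_subset fun n x hx => ?_)
  obtain ⟨m, hm⟩ : n ∈ Set.range e := by
    rw [Nat.range_nth_of_infinite hinf]
    exact ⟨x, hx⟩
  exact Set.mem_iUnion.2 ⟨m, hm ▸ hx⟩

open TopologicalSpace in
/-- A scheme of nonempty clopen sets of vanishing diameter in which the children of a set partition
it induces a homeomorphism. -/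
theorem CantorScheme.nonempty_homeomorph {X : Type*} [MetricSpace X] [CompleteSpace X]
    {A : List ℕ → Set X} (hnil : A [] = Set.univ) (hclopen : ∀ l, IsClopen (A l))
    (hne : ∀ l, (A l).Nonempty) (hdisj : CantorScheme.Disjoint A)
    (hunion : ∀ l, ⋃ n, A (n :: l) = A l) (hdiam : VanishingDiam A) :
    Nonempty (X ≃ₜ (ℕ → ℕ)) := by
  have hanti : CantorScheme.Antitone A := fun l n =>
    (Set.subset_iUnion (fun n => A (n :: l)) n).trans (hunion l).subset
  have hdom : (inducedMap A).1 = Set.univ :=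
    (hanti.closureAntitone fun l => (hclopen l).isClosed).map_of_vanishingDiam hdiam hne
  let f : (ℕ → ℕ) → X := fun x => (inducedMap A).2 ⟨x, hdom ▸ Set.mem_univ x⟩
  have hmem : ∀ x n, f x ∈ A (PiNat.res x n) := fun x n => map_mem _ n
  have hinj : Function.Injective f := fun x y h => congrArg Subtype.val (hdisj.map_injective h)
  have hcont : Continuous f := hdiam.map_continuous.comp (by fun_prop)
  have hbranch : ∀ y : X, ∃ x : ℕ → ℕ, ∀ n, y ∈ A (PiNat.res x n) := by
    intro y
    have step : ∀ l : {l // y ∈ A l}, ∃ n, y ∈ A (n :: l.1) := fun l => by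
      have := l.2
      rw [← hunion] at this
      exact Set.mem_iUnion.1 this
    choose g hg using step
    let p : ℕ → {l // y ∈ A l} := fun n =>
      Nat.rec ⟨[], hnil ▸ Set.mem_univ y⟩ (fun _ l => ⟨g l :: l.1, hg l⟩) n
    refine ⟨fun n => g (p n), fun n => ?_⟩
    have : PiNat.res (fun n => g (p n)) n = (p n).1 := by
      induction n with
      | zero => rfl
      | succ n ih => rw [PiNat.res_succ, ih]
    rw [this]
    exact (p n).2
  have huniq : ∀ x y, (∀ n, y ∈ A (PiNat.res x n)) → f x = y := by
    intro x y h
    refine dist_le_zero.1 (le_of_forall_gt fun ε hε => ?_)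
    obtain ⟨n, hn⟩ := hdiam.dist_lt ε hε x
    exact hn _ (hmem x n) _ (h n)
  have hsurj : Function.Surjective f := fun y =>
    let ⟨x, hx⟩ := hbranch y
    ⟨x, huniq x y hx⟩
  have hres : ∀ (n : ℕ) (x y : ℕ → ℕ), f y ∈ A (PiNat.res x n) →
      PiNat.res y n = PiNat.res x n := by
    intro n x y
    induction n with
    | zero => intro _; rfl
    | succ n ih =>
      intro h
      have h1 := ih (hanti _ _ h)
      have h2 := hmem y (n + 1)
      rw [PiNat.res_succ] at h h2 ⊢
      rw [PiNat.res_succ, h1]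
      rw [h1] at h2
      by_contra hxy
      exact Set.disjoint_left.1 (hdisj (PiNat.res x n) (fun h' => hxy (by rw [h']))) h2 h
  -- By disjointness, `f` maps the cylinder of `PiNat.res x n` onto the open set `A (PiNat.res x
  -- n)`.
  have hopen : IsOpenMap f := by
    refine IsOpenMap.of_nhds_le fun x => ?_
    intro s hs
    rw [Filter.mem_map] at hs
    obtain ⟨_, ⟨z, n, rfl⟩, hxz, hsub⟩ :=
      (PiNat.isTopologicalBasis_cylinders fun _ : ℕ => ℕ).mem_nhds_iff.1 hs
    rw [← PiNat.mem_cylinder_iff_eq.1 hxz] at hsub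
    refine Filter.mem_of_superset ((hclopen (PiNat.res x n)).isOpen.mem_nhds (hmem x n)) ?_
    intro y hy
    obtain ⟨w, rfl⟩ := hsurj y
    apply hsub
    rw [PiNat.cylinder_eq_res]
    exact hres n x w hy
  exact ⟨((Equiv.ofBijective f ⟨hinj, hsurj⟩).toHomeomorphOfContinuousOpen hcont hopen).symm⟩

open TopologicalSpace in
/-- The Alexandrov–Urysohn characterization of the Baire space. -/
theorem nonempty_homeomorph_nat_arrow_nat {X : Type*} [TopologicalSpace X] [PolishSpace X]
    [Nonempty X] (hX : IsTopologicalBasis {s : Set X | IsClopen s})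
    (hcomp : ∀ U : Set X, IsOpen U → U.Nonempty → ¬ IsCompact U) :
    Nonempty (X ≃ₜ (ℕ → ℕ)) := by
  let := upgradeIsCompletelyMetrizable X
  have key : ∀ (U : {U : Set X // IsClopen U ∧ U.Nonempty}) (k : ℕ),
      ∃ V : ℕ → Set X, (∀ n, IsClopen (V n)) ∧ (∀ n, (V n).Nonempty) ∧
        (∀ n, Metric.ediam (V n) ≤ ((k : ENNReal) + 1)⁻¹) ∧
        Pairwise (fun m n => Disjoint (V m) (V n)) ∧ ⋃ n, V n = U.1 := fun U k =>
    U.2.1.exists_partition hX (hcomp _ U.2.1.isOpen U.2.2)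
      (ENNReal.inv_pos.2 (ENNReal.add_ne_top.2 ⟨ENNReal.natCast_ne_top k, ENNReal.one_ne_top⟩))
  choose V hVc hVne hVd hVdisj hVU using key
  let A : List ℕ → {U : Set X // IsClopen U ∧ U.Nonempty} := fun l =>
    List.rec ⟨Set.univ, isClopen_univ, Set.univ_nonempty⟩
      (fun n l U => ⟨V U l.length n, hVc _ _ _, hVne _ _ _⟩) l
  refine CantorScheme.nonempty_homeomorph (A := fun l => (A l).1) rfl (fun l => (A l).2.1)
    (fun l => (A l).2.2) (fun l => hVdisj (A l) l.length) (fun l => hVU (A l) l.length) ?_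
  intro x
  -- The root `Set.univ` has no diameter bound; bounds start at level one.
  rw [← Filter.tendsto_add_atTop_iff_nat 1]
  refine tendsto_of_tendsto_of_tendsto_of_le_of_le tendsto_const_nhds
    ((ENNReal.tendsto_inv_nat_nhds_zero).comp (tendsto_add_atTop_nat 1)) (fun _ => zero_le) ?_
  intro n
  have := hVd (A (PiNat.res x n)) (PiNat.res x n).length (x n)
  rw [PiNat.res_length] at this
  simpa [A, PiNat.res_succ, PiNat.res_length] using this

theorem Irrational.nonempty_homeomorph_nat_arrow_nat :
    Nonempty ({x : ℝ // Irrational x} ≃ₜ (ℕ → ℕ)) := by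
  have : PolishSpace {x : ℝ // Irrational x} := IsGδ.setOfPred_irrational.polishSpace
  have : Nonempty {x : ℝ // Irrational x} := ⟨⟨_, irrational_sqrt_two⟩⟩
  refine _root_.nonempty_homeomorph_nat_arrow_nat ?_ ?_
  · refine TopologicalSpace.isTopologicalBasis_of_isOpen_of_nhds (fun _ h => h.isOpen) ?_
    intro x u hx hu
    obtain ⟨v, hv, rfl⟩ := isOpen_induced_iff.1 hu
    obtain ⟨ε, hε, hball⟩ := Metric.isOpen_iff.1 hv x hx
    obtain ⟨p, hp, hp'⟩ := exists_rat_btwn (sub_lt_self (x : ℝ) hε)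
    obtain ⟨q, hq, hq'⟩ := exists_rat_btwn (lt_add_of_pos_right (x : ℝ) hε)
    refine ⟨Subtype.val ⁻¹' Set.Ioo (p : ℝ) q, ⟨?_, ?_⟩, ⟨hp', hq⟩, fun y hy => hball ?_⟩
    -- Rational endpoints are invisible here, so the interval is clopen.
    · have : (Subtype.val ⁻¹' Set.Ioo (p : ℝ) q : Set {x : ℝ // Irrational x}) =
          Subtype.val ⁻¹' Set.Icc (p : ℝ) q := by
        ext y
        exact ⟨fun h => ⟨h.1.le, h.2.le⟩, fun h => ⟨lt_of_le_of_ne h.1 (y.2.ne_rat p).symm,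
          lt_of_le_of_ne h.2 (y.2.ne_rat q)⟩⟩
      rw [this]
      exact isClosed_Icc.preimage continuous_subtype_val
    · exact isOpen_Ioo.preimage continuous_subtype_val
    · rw [Real.ball_eq_Ioo]
      exact ⟨hp.trans hy.1, hy.2.trans hq'⟩
  · intro U hU ⟨x, hx⟩ hK
    obtain ⟨v, hv, rfl⟩ := isOpen_induced_iff.1 hU
    have hclosed := (hK.image continuous_subtype_val).isClosed
    -- A compact image is closed in `ℝ` and dense in `v`, hence would contain the rationals of `v`.
    have hsub : v ⊆ Subtype.val '' (Subtype.val ⁻¹' v : Set {x : ℝ // Irrational x}) := by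
      refine (dense_irrational.open_subset_closure_inter hv).trans
        (hclosed.closure_subset_iff.2 ?_)
      rintro y ⟨hy, hy'⟩
      exact ⟨⟨y, hy'⟩, hy, rfl⟩
    obtain ⟨_, hqv, q, rfl⟩ := Rat.isDenseEmbedding_coe_real.dense.exists_mem_open hv ⟨x, hx⟩ |>.elim
      fun q hq => (⟨_, hq, q, rfl⟩ : ∃ y ∈ v, ∃ q : ℚ, (q : ℝ) = y)
    obtain ⟨y, -, hy⟩ := hsub hqv
    exact y.2.ne_rat q hy

/-! ### Convergent sequences of `XiSpace F` and their traces. -/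

theorem IsFreeFilter.compl_mem_of_finite {F : Filter ℕ} (hF : IsFreeFilter F) {s : Set ℕ}
    (hs : s.Finite) : sᶜ ∈ F := by
  refine hs.induction_on _ (by simp) fun {n s} _ _ ih => ?_
  have hn : n ∉ ⋂₀ F.sets := by simp [hF.2]
  simp only [Set.mem_sInter, not_forall] at hn
  obtain ⟨B, hB, hnB⟩ := hn
  filter_upwards [hB, ih] with m hm hms
  rintro (rfl | h)
  · exact hnB hm
  · exact hms h

theorem ClosedHyperspace.isOpen_preimage_carrier {X : Type*} [TopologicalSpace X]
    {W : Set (Set X)} (hW : IsOpen[TopologicalSpace.vietoris X] W) :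
    IsOpen (ClosedHyperspace.carrier ⁻¹' W) :=
  ⟨W, hW, rfl⟩

namespace XiSpace

variable {F : Filter ℕ}

theorem pt_injective : Function.Injective (pt : ℕ → XiSpace F) := fun _ _ h => by
  injection h

theorem isOpen_of_notMem {U : Set (XiSpace F)} (h : limit ∉ U) : IsOpen U := by
  rw [← Set.biUnion_of_singleton U]
  refine isOpen_biUnion fun x hx => ?_
  cases x with
  | pt n => exact isOpen_singleton_pt F n
  | limit => exact absurd hx h

theorem isOpen_insert {B : Set ℕ} (hB : B ∈ F) : IsOpen (insert limit (pt '' B) : Set (XiSpace F)) := by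
  rw [isOpen_iff_mem_nhds]
  intro x hx
  cases x with
  | pt n => exact Filter.mem_of_superset ((isOpen_singleton_pt F n).mem_nhds rfl) (by simpa using hx)
  | limit => exact (mem_nhds_limit_iff F _).2 ⟨B, hB, rfl⟩

theorem preimage_pt_mem {U : Set (XiSpace F)} (hU : U ∈ 𝓝 (limit : XiSpace F)) :
    pt ⁻¹' U ∈ F := by
  obtain ⟨A, hA, rfl⟩ := (mem_nhds_limit_iff F U).1 hU
  exact Filter.mem_of_superset hA fun n hn => Or.inr ⟨n, hn, rfl⟩

end XiSpace

namespace Sc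

open XiSpace

variable {F : Filter ℕ}

/-- The set of isolated points of a sequence in `ξ(F)`. -/
def trace (S : Sc (XiSpace F)) : Set ℕ := pt ⁻¹' S.1.carrier

theorem limit_mem (S : Sc (XiSpace F)) : limit ∈ S.1.carrier := by
  obtain ⟨-, -, x, hx, hacc, -⟩ := S.2
  cases x with
  | limit => exact hx
  | pt n =>
    have := (hacc _ hx).2 rfl
    rw [accPt_iff_nhds] at this
    obtain ⟨y, ⟨rfl, -⟩, hy⟩ := this _ ((isOpen_singleton_pt F n).mem_nhds rfl)
    exact absurd rfl hy

theorem carrier_eq (S : Sc (XiSpace F)) : S.1.carrier = insert limit (pt '' trace S) := by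
  ext (n | _)
  · simp [trace]
  · simp [limit_mem]

theorem trace_infinite (S : Sc (XiSpace F)) : (trace S).Infinite := by
  intro h
  refine S.2.2.1 ?_
  rw [carrier_eq]
  exact (h.image _).insert _

theorem trace_diff_finite (S : Sc (XiSpace F)) {B : Set ℕ} (hB : B ∈ F) :
    (trace S \ B).Finite := by
  obtain ⟨-, -, x, hx, hacc, hfin⟩ := S.2
  have hx : x = limit := by
    cases x with
    | limit => rfl
    | pt n =>
      have := (hacc _ hx).2 rfl
      rw [accPt_iff_nhds] at this
      obtain ⟨y, ⟨rfl, -⟩, hy⟩ := this _ ((isOpen_singleton_pt F n).mem_nhds rfl)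
      exact absurd rfl hy
  subst hx
  refine ((hfin _ ((mem_nhds_limit_iff F _).2 ⟨B, hB, rfl⟩)).preimage
    (pt_injective.injOn)).subset ?_
  rintro n ⟨hn, hnB⟩
  exact ⟨hn, by simpa using hnB⟩

theorem trace_injective : Function.Injective (trace : Sc (XiSpace F) → Set ℕ) := fun S T h =>
  Subtype.ext (ClosedHyperspace.ext (by rw [carrier_eq, carrier_eq, h]))

/-- The sequence in `ξ(F)` with a given set of isolated points. -/
def ofTrace (A : Set ℕ) (hA : A.Infinite) (hAF : ∀ B ∈ F, (A \ B).Finite) : Sc (XiSpace F) := by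
  refine ⟨⟨insert limit (pt '' A), ?_, Set.insert_nonempty _ _⟩,
    (A.to_countable.image _).insert _,
    (hA.image pt_injective.injOn).mono (Set.subset_insert _ _), limit, Set.mem_insert _ _, ?_, ?_⟩
  · exact isOpen_compl_iff.1 (isOpen_of_notMem (by simp))
  · intro y hy
    rw [accPt_iff_nhds]
    refine ⟨fun h => ?_, ?_⟩
    · cases y with
      | limit => rfl
      | pt n =>
        obtain ⟨z, ⟨rfl, -⟩, hz⟩ := h _ ((isOpen_singleton_pt F n).mem_nhds rfl)
        exact absurd rfl hz
    · rintro rfl U hU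
      obtain ⟨n, hn⟩ := (hA.sdiff (hAF _ (preimage_pt_mem hU))).nonempty
      simp only [Set.mem_sdiff, not_and, not_not] at hn
      exact ⟨pt n, ⟨hn.2 hn.1, Or.inr ⟨n, hn.1, rfl⟩⟩, by simp⟩
  · intro U hU
    refine ((hAF _ (preimage_pt_mem hU)).image pt).subset ?_
    rintro _ ⟨rfl | ⟨n, hn, rfl⟩, hx⟩
    · exact absurd (mem_of_mem_nhds hU) hx
    · exact ⟨n, ⟨hn, hx⟩, rfl⟩

theorem trace_ofTrace (A : Set ℕ) (hA : A.Infinite) (hAF : ∀ B ∈ F, (A \ B).Finite) :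
    trace (ofTrace A hA hAF) = A := by
  ext n
  simp [trace, ofTrace]

theorem isOpen_mem_trace (n : ℕ) : IsOpen {S : Sc (XiSpace F) | n ∈ trace S} := by
  convert (ClosedHyperspace.isOpen_preimage_carrier
    (TopologicalSpace.vietoris.isOpen_inter_nonempty_of_isOpen
      (isOpen_singleton_pt F n))).preimage continuous_subtype_val using 1
  ext S
  simp [trace]

theorem isOpen_trace_subset {B : Set ℕ} (hB : B ∈ F) :
    IsOpen {S : Sc (XiSpace F) | trace S ⊆ B} := by
  convert (ClosedHyperspace.isOpen_preimage_carrier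
    (isOpen_insert hB).powerset_vietoris).preimage continuous_subtype_val using 1
  ext S
  simp [carrier_eq S, Set.subset_def]

theorem isOpen_subset_trace {s : Set ℕ} (hs : s.Finite) :
    IsOpen {S : Sc (XiSpace F) | s ⊆ trace S} := by
  have : {S : Sc (XiSpace F) | s ⊆ trace S} = ⋂ n ∈ s, {S | n ∈ trace S} := by
    ext S
    simp [Set.subset_def]
  rw [this]
  exact hs.isOpen_biInter fun n _ => isOpen_mem_trace n

theorem isClopen_mem_trace (hF : IsFreeFilter F) (n : ℕ) :
    IsClopen {S : Sc (XiSpace F) | n ∈ trace S} := by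
  refine ⟨isOpen_compl_iff.1 ?_, isOpen_mem_trace n⟩
  convert isOpen_trace_subset (hF.compl_mem_of_finite (Set.finite_singleton n)) using 1
  ext S
  simp

theorem isClopen_subset_trace (hF : IsFreeFilter F) {s : Set ℕ} (hs : s.Finite) :
    IsClopen {S : Sc (XiSpace F) | s ⊆ trace S} := by
  have : {S : Sc (XiSpace F) | s ⊆ trace S} = ⋂ n ∈ s, {S | n ∈ trace S} := by
    ext S
    simp [Set.subset_def]
  rw [this]
  exact hs.isClopen_biInter fun n _ => isClopen_mem_trace hF n

theorem isClopen_trace_subset (hF : IsFreeFilter F) {B : Set ℕ} (hB : B ∈ F) :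
    IsClopen {S : Sc (XiSpace F) | trace S ⊆ B} := by
  have : {S : Sc (XiSpace F) | trace S ⊆ B} = ⋂ n ∈ Bᶜ, {S | n ∈ trace S}ᶜ := by
    ext S
    simp [Set.subset_def, not_imp_not]
  refine ⟨?_, isOpen_trace_subset hB⟩
  rw [this]
  exact isClosed_biInter fun n _ => (isClopen_mem_trace hF n).compl.isClosed

/-- Choose a point of the sequence in each member of a Vietoris bracket. The chosen isolated points
form `s`; the choice `limit` costs nothing, since every sequence contains it. -/
theorem exists_trace_subset_of_isOpen {O : Set (Sc (XiSpace F))} (hO : IsOpen O)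
    {S : Sc (XiSpace F)} (hS : S ∈ O) :
    ∃ s : Set ℕ, s.Finite ∧ s ⊆ trace S ∧ ∃ B ∈ F, trace S ⊆ B ∧
      ∀ T : Sc (XiSpace F), s ⊆ trace T → trace T ⊆ B → T ∈ O := by
  obtain ⟨W, hW, rfl⟩ := isOpen_induced_iff.1 hO
  obtain ⟨_, ⟨𝒰, hfin, -, hopen, rfl⟩, hmem, hsub⟩ :=
    (ClosedHyperspace.isTopologicalBasis (XiSpace F)).exists_subset_of_mem_open hS hW
  have : Nonempty (XiSpace F) := ⟨limit⟩
  choose! f hf using hmem.2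
  refine ⟨pt ⁻¹' (f '' 𝒰), (hfin.image f).preimage pt_injective.injOn, ?_, pt ⁻¹' ⋃₀ 𝒰, ?_,
    fun n hn => hmem.1 hn, fun T hT hT' => hsub ⟨?_, fun U hU => ⟨f U, ?_, (hf U hU).2⟩⟩⟩
  · rintro n ⟨U, hU, h⟩
    have := (hf U hU).1
    rwa [h] at this
  · exact preimage_pt_mem ((isOpen_sUnion fun U hU => (hopen U hU).1).mem_nhds
      (hmem.1 (limit_mem S)))
  · rw [carrier_eq]
    rintro _ (rfl | ⟨n, hn, rfl⟩)
    · exact hmem.1 (limit_mem S)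
    · exact hT' hn
  · cases h : f U with
    | limit => exact limit_mem T
    | pt n => exact hT ⟨U, hU, h⟩

/-- If some sequence in `ξ(F)` has a countable neighbourhood base in `𝓢_c(ξ(F))`, then `F` has a
countable base. -/
theorem hasCountableBase (hF : IsFreeFilter F) (S : Sc (XiSpace F))
    [(𝓝 S).IsCountablyGenerated] : HasCountableBase F := by
  obtain ⟨O, hO⟩ := (𝓝 S).exists_antitone_basis
  have h1 : ∀ n, ∃ B ∈ F, trace S ⊆ B ∧ ∃ s : Set ℕ, s ⊆ trace S ∧
      ∀ T : Sc (XiSpace F), s ⊆ trace T → trace T ⊆ B → T ∈ O n := by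
    intro n
    obtain ⟨s, -, hsS, B, hB, hSB, h⟩ := exists_trace_subset_of_isOpen isOpen_interior
      (mem_interior_iff_mem_nhds.2 (hO.1.mem_of_mem trivial : O n ∈ 𝓝 S))
    exact ⟨B, hB, hSB, s, hsS, fun T h1 h2 => interior_subset (h T h1 h2)⟩
  choose B hB hSB s hsS hsub using h1
  refine ⟨Set.range fun p : ℕ × Finset ℕ => B p.1 \ p.2, Set.countable_range _, ?_, ?_⟩
  · rintro _ ⟨⟨n, t⟩, rfl⟩
    exact Filter.inter_mem (hB n) (hF.compl_mem_of_finite t.finite_toSet)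
  · intro A hA
    have hmem : {T : Sc (XiSpace F) | trace T ⊆ A ∪ trace S} ∈ 𝓝 S :=
      (isOpen_trace_subset (Filter.mem_of_superset hA Set.subset_union_left)).mem_nhds
        Set.subset_union_right
    obtain ⟨n, -, hn⟩ := hO.1.mem_iff.1 hmem
    refine ⟨_, ⟨(n, (trace_diff_finite S hA).toFinset), rfl⟩, ?_⟩
    rintro m ⟨hm, hmS⟩
    -- Adding `m ∈ B n` to `S` stays in `O n`, which forces `m ∈ A ∪ trace S`; the finite set `trace
    -- S \ A` has been removed.
    have hT := hn (hsub n (ofTrace (insert m (trace S))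
      ((trace_infinite S).mono (Set.subset_insert _ _)) fun C hC =>
        ((trace_diff_finite S hC).insert m).subset (by
          rintro k ⟨rfl | hk, hkC⟩
          · exact Or.inl rfl
          · exact Or.inr ⟨hk, hkC⟩))
      (by rw [trace_ofTrace]; exact (hsS n).trans (Set.subset_insert _ _))
      (by rw [trace_ofTrace]; exact Set.insert_subset hm (hSB n)))
    rw [Set.mem_ofPred_eq, trace_ofTrace] at hT
    rcases hT (Set.mem_insert _ _) with h | h
    · exact h
    · by_contra hmA
      exact hmS (by simpa using ⟨h, hmA⟩)

theorem isTopologicalBasis_isClopen (hF : IsFreeFilter F) :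
    TopologicalSpace.IsTopologicalBasis {s : Set (Sc (XiSpace F)) | IsClopen s} := by
  refine TopologicalSpace.isTopologicalBasis_of_isOpen_of_nhds (fun _ h => h.isOpen) ?_
  intro S O hS hO
  obtain ⟨s, hs, hsS, B, hB, hSB, h⟩ := exists_trace_subset_of_isOpen hO hS
  exact ⟨_, (isClopen_subset_trace hF hs).inter (isClopen_trace_subset hF hB), ⟨hsS, hSB⟩,
    fun T hT => h T hT.1 hT.2⟩

theorem not_isCompact_of_isOpen {O : Set (Sc (XiSpace F))}
    (hO : IsOpen O) (hne : O.Nonempty) : ¬ IsCompact O := by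
  intro hK
  obtain ⟨S, hS⟩ := hne
  obtain ⟨s, hs, hsS, B, hB, hSB, h⟩ := exists_trace_subset_of_isOpen hO hS
  obtain ⟨N, hN⟩ := hs.bddAbove
  -- These sets increase and cover the space, so compactness puts `O` inside one of them. Deleting
  -- `Set.Ioo N n` from `S` keeps `s`, hence stays in `O`, but leaves `C n`.
  let C : ℕ → Set (Sc (XiSpace F)) := fun n => {T | ∃ m, N < m ∧ m < n ∧ m ∈ trace T}
  have hC : ∀ n, IsOpen (C n) := by
    intro n
    have : C n = ⋃ m, ⋃ (_ : N < m ∧ m < n), {T | m ∈ trace T} := by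
      ext T
      simp [C, and_assoc]
    rw [this]
    exact isOpen_iUnion fun m => isOpen_iUnion fun _ => isOpen_mem_trace m
  have hmono : Monotone C := fun a b hab T ⟨m, h1, h2, h3⟩ => ⟨m, h1, h2.trans_le hab, h3⟩
  obtain ⟨n, hn⟩ := hK.elim_directed_cover C hC (fun T _ => by
    obtain ⟨m, hm, hNm⟩ := (trace_infinite T).exists_gt N
    exact Set.mem_iUnion.2 ⟨m + 1, m, hNm, Nat.lt_succ_self m, hm⟩) hmono.directed_le
  let A : Set ℕ := trace S \ Set.Ioo N n
  have hAS : A ⊆ trace S := Set.sdiff_subset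
  have hA : A.Infinite := (trace_infinite S).sdiff (Set.finite_Ioo N n)
  let T : Sc (XiSpace F) := ofTrace A hA fun C hC =>
    (trace_diff_finite S hC).subset (Set.sdiff_subset_sdiff_left hAS)
  have hT : trace T = A := trace_ofTrace _ _ _
  obtain ⟨m, h1, h2, h3⟩ := hn (h T (hT ▸ fun k hk => ⟨hsS hk, fun hk' =>
    (hN hk).not_gt hk'.1⟩) (hT ▸ hAS.trans hSB))
  rw [hT] at h3
  exact h3.2 ⟨h1, h2⟩

end Sc

/-! ### Filters with a countable base. -/

theorem HasCountableBase.isCountablyGenerated {F : Filter ℕ} (h : HasCountableBase F) :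
    F.IsCountablyGenerated := by
  obtain ⟨B, hBc, hBF, hB⟩ := h
  have : F.HasBasis (· ∈ B) id := ⟨fun A => ⟨hB A, fun ⟨b, hb, hbA⟩ =>
    Filter.mem_of_superset (hBF hb) hbA⟩⟩
  exact (HasCountableBasis.mk this hBc).isCountablyGenerated

namespace Sc

open XiSpace

variable {F : Filter ℕ}

theorem nonempty [F.IsCountablyGenerated] (hF : IsFreeFilter F) : Nonempty (Sc (XiSpace F)) := by
  have := hF.1
  obtain ⟨x, hx⟩ := F.exists_seq_tendsto
  refine ⟨ofTrace (Set.range x) (fun h => ?_) fun B hB => ?_⟩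
  · obtain ⟨n, hn⟩ := (hx.eventually (hF.compl_mem_of_finite h)).exists
    exact hn ⟨n, rfl⟩
  · have h : {n | x n ∉ B}.Finite := by
      rw [← Nat.cofinite_eq_atTop] at hx
      exact hx hB
    refine (h.image x).subset ?_
    rintro _ ⟨⟨n, rfl⟩, hn⟩
    exact ⟨n, hn, rfl⟩

/-- For a decreasing base `b`, the finite sets `trace S \ b k` embed the hyperspace in a countable
power of the discrete space `Finset ℕ`. Coherence of these sets is a closed condition and infinitude
of their union a Gδ one. -/
theorem polishSpace [F.IsCountablyGenerated] (hF : IsFreeFilter F) :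
    PolishSpace (Sc (XiSpace F)) := by
  obtain ⟨b, hb⟩ := F.exists_antitone_basis
  have hbF : ∀ k, b k ∈ F := fun k => hb.1.mem_of_mem trivial
  let : TopologicalSpace (Finset ℕ) := ⊥
  have : DiscreteTopology (Finset ℕ) := ⟨rfl⟩
  let φ : Sc (XiSpace F) → ℕ → Finset ℕ := fun S k => (trace_diff_finite S (hbF k)).toFinset
  have : PolishSpace (Finset ℕ) := inferInstance
  have hφ : ∀ S k n, n ∈ φ S k ↔ n ∈ trace S ∧ n ∉ b k := fun S k n => by simp [φ]
  have hcont : Continuous φ := by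
    refine continuous_pi fun k => continuous_iff_continuousAt.2 fun S => ?_
    rw [ContinuousAt, nhds_discrete (Finset ℕ), tendsto_pure]
    have h1 := (isOpen_subset_trace (F := F) (φ S k).finite_toSet).mem_nhds
      (show S ∈ _ from fun n hn => ((hφ S k n).1 hn).1)
    have h2 := (isOpen_trace_subset (F := F) (B := φ S k ∪ b k)
      (Filter.mem_of_superset (hbF k) Set.subset_union_right)).mem_nhds
      (show S ∈ _ from fun n hn => by
        by_cases h : n ∈ b k
        · exact Or.inr h
        · exact Or.inl ((hφ S k n).2 ⟨hn, h⟩))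
    filter_upwards [h1, h2] with T hT1 hT2
    ext n
    rw [hφ]
    exact ⟨fun h => (hT2 h.1).resolve_right h.2, fun h => ⟨hT1 h, ((hφ S k n).1 h).2⟩⟩
  have hind : IsInducing φ := by
    refine isInducing_iff_nhds.2 fun S => le_antisymm hcont.continuousAt.le_comap fun O hO => ?_
    obtain ⟨s, hs, hsS, B, hB, hSB, h⟩ := exists_trace_subset_of_isOpen isOpen_interior
      (mem_interior_iff_mem_nhds.2 hO)
    -- With `b k ⊆ B \ s`, coordinate `k` alone decides both `s ⊆ trace T` and `trace T ⊆ B`.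
    obtain ⟨k, -, hk⟩ := hb.1.mem_iff.1 (Filter.inter_mem hB (hF.compl_mem_of_finite hs))
    refine ⟨(fun g => g k) ⁻¹' {φ S k}, ((isOpen_discrete ({φ S k} : Set (Finset ℕ))).preimage
      (continuous_apply k)).mem_nhds (show φ S ∈ _ from rfl), fun T hT => interior_subset (h T ?_ ?_)⟩
    · intro n hn
      have : n ∈ φ S k := (hφ S k n).2 ⟨hsS hn, fun hnk => (hk hnk).2 hn⟩
      rw [← show φ T k = φ S k from hT] at this
      exact ((hφ T k n).1 this).1
    · intro n hn
      by_cases hnk : n ∈ b k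
      · exact (hk hnk).1
      · have : n ∈ φ T k := (hφ T k n).2 ⟨hn, hnk⟩
        rw [show φ T k = φ S k from hT] at this
        exact hSB ((hφ S k n).1 this).1
  have hfree : ∀ n, ∃ k, n ∉ b k := fun n => by
    obtain ⟨k, -, hk⟩ := hb.1.mem_iff.1 (hF.compl_mem_of_finite (Set.finite_singleton n))
    exact ⟨k, fun h => hk h rfl⟩
  have hle : ∀ S T, φ S = φ T → trace S ⊆ trace T := by
    intro S T h n hn
    obtain ⟨k, hk⟩ := hfree n
    have : n ∈ φ S k := (hφ S k n).2 ⟨hn, hk⟩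
    rw [h] at this
    exact ((hφ T k n).1 this).1
  have hinj : Function.Injective φ := fun S T h =>
    trace_injective ((hle S T h).antisymm (hle T S h.symm))
  have hrange : Set.range φ = (⋂ (j : ℕ) (k : ℕ) (_ : j ≤ k),
      {g : ℕ → Finset ℕ | ∀ n, n ∈ g j ↔ n ∈ g k ∧ n ∉ b j}) ∩
      ⋂ N, {g : ℕ → Finset ℕ | ∃ k, ∃ m ∈ g k, N < m} := by
    ext g
    simp only [Set.mem_inter_iff, Set.mem_iInter, Set.mem_ofPred_eq]
    constructor
    · rintro ⟨S, rfl⟩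
      refine ⟨fun j k hjk n => ?_, fun N => ?_⟩
      · rw [hφ, hφ]
        exact ⟨fun h => ⟨⟨h.1, fun h' => h.2 (hb.2 hjk h')⟩, h.2⟩, fun h => ⟨h.1.1, h.2⟩⟩
      · obtain ⟨m, hm, hNm⟩ := (trace_infinite S).exists_gt N
        obtain ⟨k, hk⟩ := hfree m
        exact ⟨k, m, (hφ S k m).2 ⟨hm, hk⟩, hNm⟩
    · rintro ⟨h1, h2⟩
      let A : Set ℕ := {n | ∃ k, n ∈ g k}
      have hA : ∀ j n, n ∈ A → n ∉ b j → n ∈ g j := by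
        rintro j n ⟨k, hk⟩ hn
        rcases le_total j k with h | h
        · exact (h1 j k h n).2 ⟨hk, hn⟩
        · exact ((h1 k j h n).1 hk).1
      refine ⟨ofTrace A (Set.infinite_of_forall_exists_gt fun N => ?_) fun B hB => ?_, ?_⟩
      · obtain ⟨k, m, hm, hNm⟩ := h2 N
        exact ⟨m, ⟨k, hm⟩, hNm⟩
      · obtain ⟨j, -, hj⟩ := hb.1.mem_iff.1 hB
        exact (g j).finite_toSet.subset fun n hn => hA j n hn.1 fun h => hn.2 (hj h)
      · funext j
        ext n
        rw [hφ, trace_ofTrace]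
        exact ⟨fun h => hA j n h.1 h.2, fun h => ⟨⟨j, h⟩, ((h1 j j le_rfl n).1 h).2⟩⟩
  have hGδ : IsGδ (Set.range φ) := by
    rw [hrange]
    refine IsGδ.inter (IsClosed.isGδ ?_) (.iInter_of_isOpen fun N => ?_)
    · refine isClosed_iInter fun j => isClosed_iInter fun k => isClosed_iInter fun _ => ?_
      exact (isClosed_discrete {p : Finset ℕ × Finset ℕ | ∀ n, n ∈ p.1 ↔ n ∈ p.2 ∧ n ∉ b j}).preimage
        (show Continuous fun g : ℕ → Finset ℕ => (g j, g k) by fun_prop)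
    · have : {g : ℕ → Finset ℕ | ∃ k, ∃ m ∈ g k, N < m} =
          ⋃ k, (fun g => g k) ⁻¹' {s : Finset ℕ | ∃ m ∈ s, N < m} := by
        ext g
        simp
      rw [this]
      exact isOpen_iUnion fun k => (isOpen_discrete _).preimage (continuous_apply k)
  have := hGδ.polishSpace
  exact (IsEmbedding.toHomeomorph ⟨hind, hinj⟩).isClosedEmbedding.polishSpace

end Sc

theorem mainTheorem3 (F : Filter ℕ) (hF : IsFrechetUrysohnFilter F) :
    Nonempty (Sc (XiSpace F) ≃ₜ {x : ℝ // Irrational x}) ↔ HasCountableBase F := by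
  constructor
  · rintro ⟨e⟩
    have := e.isInducing.firstCountableTopology
    exact Sc.hasCountableBase hF.1 (e.symm ⟨_, irrational_sqrt_two⟩)
  · intro h
    have := h.isCountablyGenerated
    have := Sc.polishSpace hF.1
    have := Sc.nonempty hF.1
    obtain ⟨e⟩ := nonempty_homeomorph_nat_arrow_nat (Sc.isTopologicalBasis_isClopen hF.1)
      fun _ => Sc.not_isCompact_of_isOpen
    obtain ⟨e'⟩ := Irrational.nonempty_homeomorph_nat_arrow_nat
    exact ⟨e.trans e'.symm⟩
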